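/- Let $X$ be a complex Banach space and $T$ a bounded linear operator on $X$. For $n\in\mathbb N_0$ put $k^{\alpha}(n)=\dfrac{\Gamma(\alpha+n)}{\Gamma(\alpha)\,\Gamma(n+1)}$ if $\alpha>0$ (and $k^0(n)=1$ if $n=0$, $k^0(n)=0$ otherwise), and for $\alpha\ge 0$ let $$M_T^{\alpha}(n)=\frac{1}{k^{\alpha+1}(n)}\sum_{j=0}^{n}k^{\alpha}(n-j)\,T^{j}$$ be the Cesàro mean of order $\alpha$ of $T$. For $\alpha>0$, the operator $T$ is called absolutely $(C,\alpha)$-Cesàro bounded if there is a constant $C>0$ with $$\sup_{n\in\mathbb N_0}\frac{1}{k^{\alpha+1}(n)}\sum_{j=0}^{n}k^{\alpha}(n-j)\,\|T^{j}x\|\le C\|x\|\qquad\text{for all }x\in X,$$ and $T$ is called Kreiss bounded if there is a constant $C>0$ such that every $\lambda\in\mathbb C$ with $|\lambda|>1$ lies in the resolvent set of $T$ and satisfies $\|(\lambda-T)^{-1}\|\le \dfrac{C}{|\lambda|-1}$. Let $\sigma(T)$ be the spectrum of $T$, $\partial\mathbb D$ the unit circle in $\mathbb C$, and $m$ Lebesgue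 (arc length) measure on $\partial\mathbb D$. **Theorem.** Let $\alpha\in\mathbb R$ and suppose that one of the following conditions holds: (a) $T$ is absolutely $(C,\alpha)$-Cesàro bounded and $0<\alpha\le 1$; (b) $T$ is Kreiss bounded, $1\le\alpha<2$, and $m(\sigma(T)\cap\partial\mathbb D)=0$; (c) $T$ is Kreiss bounded and $\alpha\ge 2$. Then $$\lim_{n\to\infty}\bigl\|M_T^{\alpha}(n+1)-M_T^{\alpha}(n)\bigr\|=0 ,$$ where $\|\cdot\|$ is the operator norm. -/

import Mathlib

open Filter Topology MeasureTheory

noncomputable section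

/-- The Cesàro kernel `k^α(n) = Γ(α+n) / (Γ(α) Γ(n+1))` for `α > 0`, and `k^0(n) = δ_{n,0}`. -/
def cesaroKernel (α : ℝ) (n : ℕ) : ℝ :=
  if α = 0 then (if n = 0 then 1 else 0)
  else Real.Gamma (α + n) / (Real.Gamma α * Real.Gamma ((n : ℝ) + 1))

/-- The Cesàro sum of order `α` of `T`: `∑_{j=0}^n k^α(n-j) T^j`. -/
def cesaroSum {X : Type*} [NormedAddCommGroup X] [NormedSpace ℂ X]
    (T : X →L[ℂ] X) (α : ℝ) (n : ℕ) : X →L[ℂ] X :=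
  ∑ j ∈ Finset.range (n + 1), ((cesaroKernel α (n - j) : ℝ) : ℂ) • T ^ j

/-- The Cesàro mean of order `α` of `T`: the Cesàro sum divided by `k^{α+1}(n)`. -/
def cesaroMean {X : Type*} [NormedAddCommGroup X] [NormedSpace ℂ X]
    (T : X →L[ℂ] X) (α : ℝ) (n : ℕ) : X →L[ℂ] X :=
  ((1 / cesaroKernel (α + 1) n : ℝ) : ℂ) • cesaroSum T α n

/-- Absolutely `(C, α)`-Cesàro bounded operators (for orders `α > 0`). -/
def IsAbsolutelyCesaroBounded {X : Type*} [NormedAddCommGroup X] [NormedSpace ℂ X]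
    (T : X →L[ℂ] X) (α : ℝ) : Prop :=
  ∃ C : ℝ, 0 < C ∧ ∀ (x : X) (n : ℕ),
    (1 / cesaroKernel (α + 1) n) *
      ∑ j ∈ Finset.range (n + 1), cesaroKernel α (n - j) * ‖(T ^ j) x‖ ≤ C * ‖x‖

/-- Kreiss bounded operators: every `l` with `|l| > 1` is in the resolvent set, and
`‖(l - T)⁻¹‖ ≤ C / (|l| - 1)`. -/
def IsKreissBounded {X : Type*} [NormedAddCommGroup X] [NormedSpace ℂ X]
    (T : X →L[ℂ] X) : Prop :=
  ∃ C : ℝ, 0 < C ∧ ∀ l : ℂ, 1 < ‖l‖ →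
    l ∈ resolventSet ℂ T ∧ ‖resolvent T l‖ ≤ C / (‖l‖ - 1)

/-- Lebesgue (arc length) measure on the unit circle, as a Borel measure on `ℂ`: the image of
Lebesgue measure on `(-π, π]` under `θ ↦ exp (iθ)`. -/
def unitCircleMeasure : Measure ℂ :=
  Measure.map (fun θ : ℝ => Complex.exp (θ * Complex.I))
    ((volume : Measure ℝ).restrict (Set.Ioc (-Real.pi) Real.pi))

end

/-! ### Cesàro kernels: recursion, monotonicity, growth -/

section kernel

variable {a : ℝ}

/-! Write `S^α(n)` for the Cesàro sum. Then `M^α(n+1) - M^α(n)` is at most `‖S^α(n+1) - S^α(n)‖ /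
k^{α+1}(n+1)` plus `α ‖S^α(n)‖ / ((n+1) k^{α+1}(n))` in norm, so both terms must tend to 0.

Absolutely bounded case: the second term is `O(1/n)`. Since `k^α` is antitone, its total variation
is at most 1, so `‖S^α(n+1) - S^α(n)‖ ≤ 2 max_{j ≤ n+1} ‖T^j‖`. It remains that `‖T^n‖ =
o(k^{α+1}(n))`: the hypothesis along an orbit, iterated, gains a logarithmic factor
(`IsAbsolutelyCesaroBounded.tendsto_norm_pow_div`).

Kreiss case: `S^α(n+1) - S^α(n) = S^{α-1}(n+1)` reduces both terms to `‖S^b(n)‖ = o(n k^{b+1}(n))`,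
with `b = α` and `b = α - 1` (`IsKreissBounded.tendsto_norm_cesaroSum_div`). Cauchy's formula on the
circle of radius `(n+1)/(n+2)` bounds `‖S^b(n)‖` by the integral of a scalar Cesàro sum times `‖(1 -
zT)⁻¹‖`. After normalization both factors are bounded, and one tends to 0 almost everywhere: the
scalar one if `b > 0`, the resolvent one if the spectrum is null on the circle. Dominated
convergence concludes. -/

theorem cesaroKernel_apply_zero (ha : 0 ≤ a) : cesaroKernel a 0 = 1 := by
  rcases ha.eq_or_lt with rfl | ha
  · simp [cesaroKernel]
  · simp [cesaroKernel, ha.ne', (Real.Gamma_pos_of_pos ha).ne']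

theorem cesaroKernel_succ (ha : 0 ≤ a) (n : ℕ) :
    cesaroKernel a (n + 1) = cesaroKernel a n * ((a + n) / (n + 1)) := by
  rcases ha.eq_or_lt with rfl | ha
  · rcases n with _ | n <;> simp [cesaroKernel]
  · have h1 : (0 : ℝ) < a + n := by positivity
    have h2 : (0 : ℝ) < (n : ℝ) + 1 := by positivity
    have h3 := (Real.Gamma_pos_of_pos ha).ne'
    have h4 := (Real.Gamma_pos_of_pos h2).ne'
    simp only [cesaroKernel, ha.ne', if_false]
    push_cast
    rw [← add_assoc, Real.Gamma_add_one h1.ne', Real.Gamma_add_one h2.ne']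
    field_simp

theorem cesaroKernel_nonneg (ha : 0 ≤ a) (n : ℕ) : 0 ≤ cesaroKernel a n := by
  induction n with
  | zero => simp [cesaroKernel_apply_zero ha]
  | succ n ih => rw [cesaroKernel_succ ha]; positivity

theorem cesaroKernel_pos (ha : 0 < a) (n : ℕ) : 0 < cesaroKernel a n := by
  induction n with
  | zero => simp [cesaroKernel_apply_zero ha.le]
  | succ n ih => rw [cesaroKernel_succ ha.le]; positivity

theorem mul_cesaroKernel_add_one (ha : 0 ≤ a) (n : ℕ) :
    a * cesaroKernel (a + 1) n = (a + n) * cesaroKernel a n := by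
  induction n with
  | zero => simp [cesaroKernel_apply_zero ha, cesaroKernel_apply_zero (add_nonneg ha zero_le_one)]
  | succ n ih =>
    rw [cesaroKernel_succ ha, cesaroKernel_succ (by positivity), ← mul_assoc, ih]
    push_cast
    ring

theorem cesaroKernel_add_one_succ_sub (ha : 0 ≤ a) (n : ℕ) :
    cesaroKernel (a + 1) (n + 1) - cesaroKernel (a + 1) n = cesaroKernel a (n + 1) := by
  have h := mul_cesaroKernel_add_one ha n
  have h2 : (n : ℝ) + 1 ≠ 0 := by positivity
  rw [cesaroKernel_succ ha, cesaroKernel_succ (by positivity)]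
  field_simp
  linear_combination h

theorem monotone_cesaroKernel (ha : 1 ≤ a) : Monotone (cesaroKernel a) := by
  refine monotone_nat_of_le_succ fun n => ?_
  have h := cesaroKernel_add_one_succ_sub (sub_nonneg.2 ha) n
  have h' := cesaroKernel_nonneg (sub_nonneg.2 ha) (n + 1)
  rw [sub_add_cancel] at h
  linarith

theorem antitone_cesaroKernel (ha : 0 ≤ a) (ha' : a ≤ 1) : Antitone (cesaroKernel a) := by
  refine antitone_nat_of_succ_le fun n => ?_
  rw [cesaroKernel_succ ha]
  refine mul_le_of_le_one_right (cesaroKernel_nonneg ha n) ((div_le_one (by positivity)).2 ?_)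
  linarith

theorem one_le_cesaroKernel (ha : 1 ≤ a) (n : ℕ) : 1 ≤ cesaroKernel a n := by
  have h := monotone_cesaroKernel ha (Nat.zero_le n)
  rwa [cesaroKernel_apply_zero (by linarith)] at h

theorem sum_cesaroKernel (ha : 0 ≤ a) (n : ℕ) :
    ∑ j ∈ Finset.range (n + 1), cesaroKernel a (n - j) = cesaroKernel (a + 1) n := by
  have h := Finset.sum_range_reflect (cesaroKernel a) (n + 1)
  simp only [add_tsub_cancel_right] at h
  rw [h]
  clear h
  induction n with
  | zero => simp [cesaroKernel_apply_zero ha, cesaroKernel_apply_zero (add_nonneg ha zero_le_one)]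
  | succ n ih => rw [Finset.sum_range_succ, ih, ← cesaroKernel_add_one_succ_sub ha]; ring

theorem tendsto_cesaroKernel_atTop (ha : 1 < a) : Tendsto (cesaroKernel a) atTop atTop := by
  -- Each increment is `k^a(n) (a-1)/(n+1)`, and `k^a(n) ≥ 1`: comparison with the harmonic series.
  have key : ∀ n : ℕ, (a - 1) * ∑ i ∈ Finset.range n, (1 / ((i : ℝ) + 1)) ≤ cesaroKernel a n := by
    intro n
    induction n with
    | zero => simp [cesaroKernel_apply_zero (zero_le_one.trans ha.le)]
    | succ n ih =>
      have h1 := one_le_cesaroKernel ha.le n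
      have h3 : (0 : ℝ) ≤ (a - 1) / ((n : ℝ) + 1) := div_nonneg (by linarith) (by positivity)
      have h2 : (a + n) / ((n : ℝ) + 1) = 1 + (a - 1) / ((n : ℝ) + 1) := by field_simp; ring
      rw [Finset.sum_range_succ, cesaroKernel_succ (by linarith), h2, mul_add, mul_one_div]
      nlinarith
  exact tendsto_atTop_mono key
    (Real.tendsto_sum_range_one_div_nat_succ_atTop.const_mul_atTop (sub_pos.2 ha))

theorem sum_abs_sub_of_monotone_or_antitone {c : ℕ → ℝ} (hc : Monotone c ∨ Antitone c) (n : ℕ) :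
    ∑ i ∈ Finset.range n, |c (i + 1) - c i| = |c n - c 0| := by
  rcases hc with hc | hc
  · rw [abs_of_nonneg (sub_nonneg.2 (hc (Nat.zero_le n))), ← Finset.sum_range_sub]
    exact Finset.sum_congr rfl fun i _ => abs_of_nonneg (sub_nonneg.2 (hc (Nat.le_succ i)))
  · rw [abs_of_nonpos (sub_nonpos.2 (hc (Nat.zero_le n))), ← Finset.sum_range_sub,
      ← Finset.sum_neg_distrib]
    exact Finset.sum_congr rfl fun i _ => abs_of_nonpos (sub_nonpos.2 (hc (Nat.le_succ i)))

end kernel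

/-! ### Kernel convolutions, used both for `T` and for complex scalars -/

section convolution

variable {A : Type*} [NormedRing A] [NormedAlgebra ℂ A]

/-- The convolution `∑_{j=0}^n c(n-j) x^j` of a real sequence with the powers of `x`. -/
def powerConvolution (c : ℕ → ℝ) (x : A) (n : ℕ) : A :=
  ∑ j ∈ Finset.range (n + 1), ((c (n - j) : ℝ) : ℂ) • x ^ j

theorem powerConvolution_succ_eq_mul (c : ℕ → ℝ) (x : A) (n : ℕ) :
    powerConvolution c x (n + 1) = x * powerConvolution c x n + ((c (n + 1) : ℝ) : ℂ) • 1 := by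
  rw [powerConvolution, Finset.sum_range_succ', powerConvolution, Finset.mul_sum]
  simp [pow_succ']

theorem powerConvolution_succ_sub (c : ℕ → ℝ) (x : A) (n : ℕ) :
    powerConvolution c x (n + 1) - powerConvolution c x n =
      ∑ j ∈ Finset.range (n + 1), ((c (n - j + 1) - c (n - j) : ℝ) : ℂ) • x ^ j
        + ((c 0 : ℝ) : ℂ) • x ^ (n + 1) := by
  rw [powerConvolution, Finset.sum_range_succ, powerConvolution, add_sub_right_comm,
    ← Finset.sum_sub_distrib]
  simp only [tsub_self]
  congr 1
  refine Finset.sum_congr rfl fun j hj => ?_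
  rw [Nat.succ_sub (Nat.lt_succ_iff.1 (Finset.mem_range.1 hj))]
  push_cast
  rw [sub_smul]

/-- The coefficients of the difference are increments of `c`; for monotone or antitone `c` their
absolute values telescope. -/
theorem norm_powerConvolution_succ_sub_le {c : ℕ → ℝ} (hc : Monotone c ∨ Antitone c) {x : A}
    {n : ℕ} {D : ℝ} (hD : ∀ j ≤ n + 1, ‖x ^ j‖ ≤ D) :
    ‖powerConvolution c x (n + 1) - powerConvolution c x n‖ ≤ (|c (n + 1) - c 0| + |c 0|) * D := by
  rw [powerConvolution_succ_sub, add_mul]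
  refine (norm_add_le _ _).trans (add_le_add ?_ ?_)
  · have h := Finset.sum_range_reflect (fun i => |c (i + 1) - c i|) (n + 1)
    simp only [add_tsub_cancel_right] at h
    rw [← sum_abs_sub_of_monotone_or_antitone hc, ← h, Finset.sum_mul]
    refine norm_sum_le_of_le _ fun j hj => ?_
    rw [norm_smul, Complex.norm_real, Real.norm_eq_abs]
    exact mul_le_mul_of_nonneg_left (hD j (Finset.mem_range.1 hj).le) (abs_nonneg _)
  · rw [norm_smul, Complex.norm_real, Real.norm_eq_abs]
    exact mul_le_mul_of_nonneg_left (hD _ le_rfl) (abs_nonneg _)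

theorem norm_powerConvolution_le {c : ℕ → ℝ} (hc : ∀ n, 0 ≤ c n) {x : A}
    {n : ℕ} {D : ℝ} (hD : ∀ j ≤ n, ‖x ^ j‖ ≤ D) :
    ‖powerConvolution c x n‖ ≤ (∑ j ∈ Finset.range (n + 1), c (n - j)) * D := by
  rw [powerConvolution, Finset.sum_mul]
  refine norm_sum_le_of_le _ fun j hj => ?_
  rw [norm_smul, Complex.norm_real, Real.norm_of_nonneg (hc _)]
  exact mul_le_mul_of_nonneg_left (hD j (Nat.lt_succ_iff.1 (Finset.mem_range.1 hj))) (hc _)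

/-- Abel summation: multiplying by `z - 1` turns the convolution into its own forward difference, up
to the boundary term `c (n + 1)`. -/
theorem norm_sub_one_mul_powerConvolution_le {c : ℕ → ℝ} (hc : Monotone c ∨ Antitone c)
    (hc0 : ∀ n, 0 ≤ c n) {z : ℂ} {n : ℕ} {D : ℝ} (hD : ∀ j ≤ n + 1, ‖z ^ j‖ ≤ D) :
    ‖z - 1‖ * ‖powerConvolution c z n‖ ≤ 2 * (c (n + 1) + c 0) * D := by
  have h := norm_powerConvolution_succ_sub_le hc hD
  have h1 : 1 ≤ D := by simpa using hD 0 (Nat.zero_le _)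
  have e : (z - 1) * powerConvolution c z n =
      (powerConvolution c z (n + 1) - powerConvolution c z n) - ((c (n + 1) : ℝ) : ℂ) := by
    rw [powerConvolution_succ_eq_mul]
    simp only [smul_eq_mul]
    ring
  have h2 : |c (n + 1) - c 0| + |c 0| ≤ c (n + 1) + 2 * c 0 := by
    rw [abs_of_nonneg (hc0 0)]
    have := abs_sub (c (n + 1)) (c 0)
    rw [abs_of_nonneg (hc0 0), abs_of_nonneg (hc0 (n + 1))] at this
    linarith
  rw [← norm_mul, e]
  refine (norm_sub_le _ _).trans ?_
  rw [Complex.norm_real, Real.norm_of_nonneg (hc0 _)]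
  nlinarith [mul_le_mul_of_nonneg_right h2 (zero_le_one.trans h1), hc0 (n + 1)]

end convolution

/-! ### Differences of Cesàro means -/

section mean

variable {X : Type*} [NormedAddCommGroup X] [NormedSpace ℂ X]

theorem cesaroSum_eq_powerConvolution (T : X →L[ℂ] X) (a : ℝ) (n : ℕ) :
    cesaroSum T a n = powerConvolution (cesaroKernel a) T n := rfl

theorem cesaroSum_add_one_succ_sub (T : X →L[ℂ] X) {a : ℝ} (ha : 0 ≤ a) (n : ℕ) :
    cesaroSum T (a + 1) (n + 1) - cesaroSum T (a + 1) n = cesaroSum T a (n + 1) := by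
  rw [cesaroSum_eq_powerConvolution, cesaroSum_eq_powerConvolution, powerConvolution_succ_sub,
    cesaroSum, Finset.sum_range_succ _ (n + 1)]
  simp only [tsub_self, cesaroKernel_apply_zero ha,
    cesaroKernel_apply_zero (add_nonneg ha zero_le_one)]
  congr 1
  refine Finset.sum_congr rfl fun j hj => ?_
  rw [cesaroKernel_add_one_succ_sub ha, Nat.succ_sub (Nat.lt_succ_iff.1 (Finset.mem_range.1 hj))]

theorem norm_cesaroMean_succ_sub_le (T : X →L[ℂ] X) {a : ℝ} (ha : 0 ≤ a) (n : ℕ) :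
    ‖cesaroMean T a (n + 1) - cesaroMean T a n‖ ≤
      ‖cesaroSum T a (n + 1) - cesaroSum T a n‖ / cesaroKernel (a + 1) (n + 1) +
        a * (‖cesaroSum T a n‖ / ((n + 1) * cesaroKernel (a + 1) n)) := by
  have hk := cesaroKernel_pos (by linarith : 0 < a + 1) n
  have hk' := cesaroKernel_pos (by linarith : 0 < a + 1) (n + 1)
  have hn : (0 : ℝ) < a + 1 + n := by positivity
  have e : (1 / cesaroKernel (a + 1) n : ℝ) =
      1 / cesaroKernel (a + 1) (n + 1) + a / ((a + 1 + n) * cesaroKernel (a + 1) n) := by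
    rw [cesaroKernel_succ (by linarith)]
    field_simp
    ring
  have e' : cesaroMean T a (n + 1) - cesaroMean T a n =
      ((1 / cesaroKernel (a + 1) (n + 1) : ℝ) : ℂ) • (cesaroSum T a (n + 1) - cesaroSum T a n) -
      ((a / ((a + 1 + n) * cesaroKernel (a + 1) n) : ℝ) : ℂ) • cesaroSum T a n := by
    rw [cesaroMean, cesaroMean, e, Complex.ofReal_add, add_smul, smul_sub]
    abel
  rw [e']
  refine (norm_sub_le _ _).trans (add_le_add ?_ ?_)
  · rw [norm_smul, Complex.norm_real, Real.norm_of_nonneg (by positivity), one_div_mul_eq_div]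
  · rw [norm_smul, Complex.norm_real, Real.norm_of_nonneg (by positivity), div_mul_eq_mul_div,
      mul_div_assoc]
    gcongr a * (_ / (?_ * _))
    linarith

theorem tendsto_norm_cesaroMean_succ_sub {T : X →L[ℂ] X} {a : ℝ} (ha : 0 ≤ a)
    (h1 : Tendsto (fun n => ‖cesaroSum T a (n + 1) - cesaroSum T a n‖ /
      cesaroKernel (a + 1) (n + 1)) atTop (𝓝 0))
    (h2 : Tendsto (fun n : ℕ => ‖cesaroSum T a n‖ / ((n + 1) * cesaroKernel (a + 1) n))
      atTop (𝓝 0)) :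
    Tendsto (fun n : ℕ => ‖cesaroMean T a (n + 1) - cesaroMean T a n‖) atTop (𝓝 0) := by
  refine squeeze_zero (fun _ => norm_nonneg _) (norm_cesaroMean_succ_sub_le T ha) ?_
  simpa using h1.add (h2.const_mul a)

end mean

/-! ### Absolutely Cesàro bounded operators -/

section absolutely

variable {X : Type*} [NormedAddCommGroup X] [NormedSpace ℂ X] {T : X →L[ℂ] X} {a : ℝ}

theorem IsAbsolutelyCesaroBounded.exists_one_le (h : IsAbsolutelyCesaroBounded T a) (ha : 0 < a) :
    ∃ C : ℝ, 1 ≤ C ∧ ∀ (x : X) (n : ℕ),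
      ∑ i ∈ Finset.range (n + 1), cesaroKernel a i * ‖(T ^ (n - i)) x‖ ≤
        C * cesaroKernel (a + 1) n * ‖x‖ := by
  obtain ⟨C, -, hC⟩ := h
  refine ⟨max C 1, le_max_right _ _, fun x n => ?_⟩
  have hk := cesaroKernel_pos (by linarith : 0 < a + 1) n
  have h1 := hC x n
  have h2 := Finset.sum_range_reflect (fun i => cesaroKernel a i * ‖(T ^ (n - i)) x‖) (n + 1)
  simp only [add_tsub_cancel_right] at h2
  rw [← h2]
  have h3 : ∑ j ∈ Finset.range (n + 1), cesaroKernel a (n - j) * ‖(T ^ (n - (n - j))) x‖ =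
      ∑ j ∈ Finset.range (n + 1), cesaroKernel a (n - j) * ‖(T ^ j) x‖ := by
    refine Finset.sum_congr rfl fun j hj => ?_
    rw [Nat.sub_sub_self (Nat.lt_succ_iff.1 (Finset.mem_range.1 hj))]
  rw [h3]
  rw [one_div_mul_eq_div, div_le_iff₀ hk] at h1
  refine h1.trans ?_
  rw [mul_right_comm]
  gcongr
  exact le_max_left _ _

theorem IsAbsolutelyCesaroBounded.tendsto_norm_pow_div (h : IsAbsolutelyCesaroBounded T a)
    (ha : 0 < a) :
    Tendsto (fun n => ‖T ^ n‖ / cesaroKernel (a + 1) n) atTop (𝓝 0) := by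
  obtain ⟨C, hC1, hC⟩ := h.exists_one_le ha
  have hC0 : 0 < C := by linarith
  set H : ℕ → ℝ := fun n => ∑ i ∈ Finset.range n, (1 / ((i : ℝ) + 1)) with hH
  set d : ℝ := a / (C * (a + 1)) with hd
  have hd0 : 0 < d := by positivity
  have hH0 : ∀ n, 0 ≤ H n := fun n => Finset.sum_nonneg fun i _ => by positivity
  -- With `B_N` the right-hand side, the hypothesis at `T^(n-N-1) x` makes the next summand at least
  -- `a B_N / (C (a+N+1))`. As `B_N ≥ ‖T^n x‖` and `a+N+1 ≤ (a+1)(N+1)`, each step gains `d ‖T^n x‖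
  -- / (N+1)`.
  have lower : ∀ (x : X) (n N : ℕ), N ≤ n → (1 + d * H N) * ‖(T ^ n) x‖ ≤
      ∑ i ∈ Finset.range (N + 1), cesaroKernel a i * ‖(T ^ (n - i)) x‖ := by
    intro x n N
    induction N with
    | zero => simp [hH, cesaroKernel_apply_zero ha.le]
    | succ N ih =>
      intro hN
      have ih' := ih (by omega)
      set B := ∑ i ∈ Finset.range (N + 1), cesaroKernel a i * ‖(T ^ (n - i)) x‖ with hB
      have hBn : ‖(T ^ n) x‖ ≤ B :=
        le_trans (le_mul_of_one_le_left (norm_nonneg _)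
          (le_add_of_nonneg_right (mul_nonneg hd0.le (hH0 N)))) ih'
      have h1 := hC ((T ^ (n - (N + 1))) x) (N + 1)
      have h2 : ∑ i ∈ Finset.range (N + 1 + 1), cesaroKernel a i *
            ‖(T ^ (N + 1 - i)) ((T ^ (n - (N + 1))) x)‖ =
          ∑ i ∈ Finset.range (N + 1 + 1), cesaroKernel a i * ‖(T ^ (n - i)) x‖ := by
        refine Finset.sum_congr rfl fun i hi => ?_
        have := Finset.mem_range.1 hi
        rw [← mul_apply_eq_comp, ← pow_add]
        congr 4
        omega
      rw [h2, Finset.sum_range_succ, ← hB] at h1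
      rw [Finset.sum_range_succ, ← hB]
      set u := ‖(T ^ (n - (N + 1))) x‖
      set k := cesaroKernel a (N + 1)
      have hk : a * cesaroKernel (a + 1) (N + 1) = (a + (N + 1 : ℕ)) * k :=
        mul_cesaroKernel_add_one ha.le _
      have hku : 0 ≤ k * u := mul_nonneg (cesaroKernel_nonneg ha.le _) (norm_nonneg _)
      have h3 : a * B ≤ C * (a + (N + 1 : ℕ)) * (k * u) := by
        calc a * B ≤ a * (C * cesaroKernel (a + 1) (N + 1) * u) := by gcongr; linarith
          _ = C * (a * cesaroKernel (a + 1) (N + 1)) * u := by ring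
          _ = _ := by rw [hk]; ring
      have h4 : C * (a + (N + 1 : ℕ)) * (k * u) ≤ C * ((a + 1) * (N + 1)) * (k * u) := by
        gcongr
        push_cast
        nlinarith [mul_nonneg ha.le (Nat.cast_nonneg (α := ℝ) N)]
      have h5 : d * (1 / ((N : ℝ) + 1)) * ‖(T ^ n) x‖ ≤ k * u := by
        have : d * (1 / ((N : ℝ) + 1)) * ‖(T ^ n) x‖ =
            a * ‖(T ^ n) x‖ / (C * ((a + 1) * (N + 1))) := by rw [hd]; field_simp
        rw [this, div_le_iff₀ (by positivity)]
        have := mul_le_mul_of_nonneg_left hBn ha.le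
        linarith
      have h6 : H (N + 1) = H N + 1 / ((N : ℝ) + 1) := by simp only [hH, Finset.sum_range_succ]
      rw [h6]
      linarith
  have bound : ∀ n, ‖T ^ n‖ / cesaroKernel (a + 1) n ≤ C * (1 + d * H n)⁻¹ := by
    intro n
    have hk := cesaroKernel_pos (by linarith : 0 < a + 1) n
    have hp : 0 < 1 + d * H n := by have := mul_nonneg hd0.le (hH0 n); linarith
    rw [div_le_iff₀ hk]
    refine ContinuousLinearMap.opNorm_le_bound _ (by positivity) fun x => ?_
    have h1 := (lower x n n le_rfl).trans (hC x n)
    rw [mul_comm, ← le_div_iff₀ hp] at h1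
    refine h1.trans (le_of_eq ?_)
    field_simp
  refine squeeze_zero (fun n => div_nonneg (norm_nonneg _)
    (cesaroKernel_nonneg (by linarith) n)) bound ?_
  have hlim : Tendsto (fun n => 1 + d * H n) atTop atTop :=
    tendsto_atTop_add_const_left _ _
      (Real.tendsto_sum_range_one_div_nat_succ_atTop.const_mul_atTop hd0)
  simpa using hlim.inv_tendsto_atTop.const_mul C

/-- Finitely many early terms are absorbed by `k → ∞`, the others by monotonicity of `k`. -/
theorem eventually_forall_le_mul_of_tendsto_div {u k : ℕ → ℝ} (hk : ∀ n, 0 < k n) (hmono : Monotone k)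
    (htop : Tendsto k atTop atTop) (h : Tendsto (fun n => u n / k n) atTop (𝓝 0)) {ε : ℝ}
    (hε : 0 < ε) : ∀ᶠ n in atTop, ∀ j ≤ n, u j ≤ ε * k n := by
  obtain ⟨N, hN⟩ := eventually_atTop.1 (h.eventually_lt_const hε)
  have h1 : ∀ᶠ n in atTop, ∀ j ∈ Finset.range N, u j ≤ ε * k n := by
    rw [Filter.eventually_all_finset]
    exact fun j _ => (htop.const_mul_atTop hε).eventually_ge_atTop (u j)
  filter_upwards [h1] with n hn j hj
  by_cases hjN : j < N
  · exact hn j (Finset.mem_range.2 hjN)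
  · refine ((div_lt_iff₀ (hk j)).1 (hN j (not_lt.1 hjN))).le.trans ?_
    exact mul_le_mul_of_nonneg_left (hmono hj) hε.le

theorem IsAbsolutelyCesaroBounded.tendsto_norm_cesaroMean_succ_sub
    (h : IsAbsolutelyCesaroBounded T a) (ha : 0 < a) (ha1 : a ≤ 1) :
    Tendsto (fun n : ℕ => ‖cesaroMean T a (n + 1) - cesaroMean T a n‖) atTop (𝓝 0) := by
  have hk : ∀ n, 0 < cesaroKernel (a + 1) n := cesaroKernel_pos (by linarith)
  have hmono := monotone_cesaroKernel (by linarith : 1 ≤ a + 1)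
  have hsmall := fun ε => eventually_forall_le_mul_of_tendsto_div (ε := ε) hk hmono
    (tendsto_cesaroKernel_atTop (by linarith)) (h.tendsto_norm_pow_div ha)
  refine _root_.tendsto_norm_cesaroMean_succ_sub ha.le ?_ ?_
  · have hev : ∀ ε > 0, ∀ᶠ n in atTop, ‖cesaroSum T a n - cesaroSum T a (n - 1)‖ /
        cesaroKernel (a + 1) n ≤ ε := by
      intro ε hε
      filter_upwards [hsmall (ε / 2) (by positivity), eventually_ge_atTop 1] with n hn hn1
      obtain ⟨m, rfl⟩ := Nat.exists_eq_add_of_le' hn1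
      have h1 := norm_powerConvolution_succ_sub_le
        (Or.inr (antitone_cesaroKernel ha.le ha1)) (x := T) (n := m) hn
      have h2 := antitone_cesaroKernel ha.le ha1 (Nat.zero_le (m + 1))
      have h3 := cesaroKernel_nonneg ha.le (m + 1)
      rw [cesaroKernel_apply_zero ha.le] at h1 h2
      -- The constant becomes `2 - k^a(m+1) ≤ 2`, hence the choice of `ε / 2`.
      rw [abs_of_nonpos (by linarith), abs_one] at h1
      rw [div_le_iff₀ (hk _)]
      refine h1.trans ?_
      have h4 : 0 ≤ ε / 2 * cesaroKernel (a + 1) (m + 1) :=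
        mul_nonneg (by positivity) (hk _).le
      nlinarith
    have : Tendsto (fun n => ‖cesaroSum T a n - cesaroSum T a (n - 1)‖ /
        cesaroKernel (a + 1) n) atTop (𝓝 0) := by
      refine Metric.tendsto_nhds.2 fun ε hε => ?_
      filter_upwards [hev (ε / 2) (by positivity)] with n hn
      rw [Real.dist_0_eq_abs, abs_of_nonneg (div_nonneg (norm_nonneg _) (hk n).le)]
      linarith
    exact this.comp (tendsto_add_atTop_nat 1)
  · obtain ⟨C, hC1, hC⟩ := h.exists_one_le ha
    have hb : ∀ n : ℕ, ‖cesaroSum T a n‖ / ((n + 1) * cesaroKernel (a + 1) n) ≤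
        C * (1 / ((n : ℝ) + 1)) := by
      intro n
      have := hk n
      rw [div_le_iff₀ (by positivity)]
      have e : C * (1 / ((n : ℝ) + 1)) * ((n + 1) * cesaroKernel (a + 1) n) =
          C * cesaroKernel (a + 1) n := by field_simp
      rw [e]
      refine ContinuousLinearMap.opNorm_le_bound _ (by positivity) fun x => ?_
      refine le_trans ?_ (hC x n)
      have h2 := Finset.sum_range_reflect (fun i => cesaroKernel a i * ‖(T ^ (n - i)) x‖) (n + 1)
      simp only [add_tsub_cancel_right] at h2
      rw [← h2, cesaroSum, _root_.sum_apply]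
      refine norm_sum_le_of_le _ fun j hj => ?_
      rw [Nat.sub_sub_self (Nat.lt_succ_iff.1 (Finset.mem_range.1 hj)),
        _root_.smul_apply, norm_smul, Complex.norm_real,
        Real.norm_of_nonneg (cesaroKernel_nonneg ha.le _)]
    refine squeeze_zero (fun n => div_nonneg (norm_nonneg _)
      (mul_nonneg (by positivity) (hk n).le)) hb ?_
    simpa using tendsto_one_div_add_atTop_nhds_zero_nat.const_mul C

end absolutely

/-! ### Kreiss bounded operators -/

section kreiss

variable {X : Type*} [NormedAddCommGroup X] [NormedSpace ℂ X] {T : X →L[ℂ] X}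

theorem ringInverse_one_sub_smul_eq_inv_smul_resolvent {A : Type*} [Ring A] [Algebra ℂ A] (x : A)
    {z : ℂ} (hz : z ≠ 0) : Ring.inverse (1 - z • x) = z⁻¹ • resolvent x z⁻¹ := by
  have h := spectrum.units_smul_resolvent_self (r := (Units.mk0 z hz)⁻¹) (a := x)
  simp only [Units.smul_def, Units.val_inv_eq_inv_val, Units.val_mk0, inv_inv] at h
  rw [h, resolvent, map_one]

theorem spectralRadius_le_one_of_isKreissBounded (h : IsKreissBounded T) :
    spectralRadius ℂ T ≤ 1 := by
  obtain ⟨C, -, hC⟩ := h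
  refine iSup₂_le fun l hl => ?_
  by_contra! hlt
  refine hl (hC l ?_).1
  exact_mod_cast hlt

theorem IsKreissBounded.exists_norm_inverse_le (h : IsKreissBounded T) :
    ∃ C : ℝ, 0 < C ∧ ∀ z : ℂ, z ≠ 0 → ‖z‖ < 1 → ‖Ring.inverse (1 - z • T)‖ ≤ C / (1 - ‖z‖) := by
  obtain ⟨C, hC0, hC⟩ := h
  refine ⟨C, hC0, fun z hz hz1 => ?_⟩
  have hz0 : 0 < ‖z‖ := norm_pos_iff.2 hz
  have h1 := (hC z⁻¹ (by rw [norm_inv]; exact (one_lt_inv₀ hz0).2 hz1)).2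
  rw [ringInverse_one_sub_smul_eq_inv_smul_resolvent T hz, norm_smul, norm_inv]
  rw [norm_inv] at h1
  calc ‖z‖⁻¹ * ‖resolvent T z⁻¹‖ ≤ ‖z‖⁻¹ * (C / (‖z‖⁻¹ - 1)) := by gcongr
    _ = C / (1 - ‖z‖) := by
      have : (1 : ℝ) - ‖z‖ ≠ 0 := by linarith
      have h' : ‖z‖⁻¹ - 1 ≠ 0 := by
        have := (one_lt_inv₀ hz0).2 hz1
        linarith
      field_simp

variable [CompleteSpace X]

theorem IsKreissBounded.differentiableOn_inverse_one_sub_smul (h : IsKreissBounded T) {r : NNReal}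
    (hr : r < 1) : DifferentiableOn ℂ (fun z : ℂ => Ring.inverse (1 - z • T))
      (Metric.closedBall 0 r) := by
  refine spectrum.differentiableOn_inverse_one_sub_smul (lt_of_lt_of_le ?_
    (ENNReal.inv_le_inv.2 (spectralRadius_le_one_of_isKreissBounded h)))
  simpa using hr

/-- The Neumann series and the Cauchy series of `(1 - zT)⁻¹` at 0 have the same coefficients. -/
theorem IsKreissBounded.pow_eq_circleIntegral (h : IsKreissBounded T) {r : NNReal}
    (hr0 : 0 < r) (hr : r < 1) (n : ℕ) :
    T ^ n = (2 * Real.pi * Complex.I : ℂ)⁻¹ •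
      ∮ z in C(0, r), z⁻¹ • (z⁻¹) ^ n • Ring.inverse (1 - z • T) := by
  have h1 := ((h.differentiableOn_inverse_one_sub_smul hr).hasFPowerSeriesOnBall
    hr0).hasFPowerSeriesAt
  have h2 := (spectrum.hasFPowerSeriesOnBall_inverse_one_sub_smul ℂ T).hasFPowerSeriesAt
  have h3 := congrArg (fun p => p n fun _ => 1) (h2.eq_formalMultilinearSeries h1)
  simp only [cauchyPowerSeries_apply, ContinuousMultilinearMap.mkPiRing_apply, sub_zero, one_div,
    Finset.prod_const_one, one_smul] at h3
  rw [h3]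
  exact congrArg _ (congrArg (fun f => circleIntegral f 0 r) (funext fun z => smul_comm _ _ _))

theorem IsKreissBounded.continuous_inverse_circleMap (h : IsKreissBounded T) {r : NNReal}
    (hr : r < 1) :
    Continuous fun θ : ℝ => Ring.inverse (1 - circleMap 0 r θ • T) := by
  refine (h.differentiableOn_inverse_one_sub_smul hr).continuousOn.comp_continuous
    (continuous_circleMap 0 r) fun θ => ?_
  exact circleMap_mem_closedBall 0 r.2 θ

theorem IsKreissBounded.pow_eq_integral (h : IsKreissBounded T) {r : NNReal}
    (hr0 : 0 < r) (hr : r < 1) (n : ℕ) :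
    T ^ n = (2 * Real.pi : ℂ)⁻¹ • ∫ θ in (0 : ℝ)..2 * Real.pi,
      ((circleMap 0 r θ)⁻¹) ^ n • Ring.inverse (1 - circleMap 0 r θ • T) := by
  rw [h.pow_eq_circleIntegral hr0 hr n, circleIntegral]
  have e : ∀ θ : ℝ, deriv (circleMap 0 r) θ • (circleMap 0 r θ)⁻¹ • ((circleMap 0 r θ)⁻¹) ^ n •
      Ring.inverse (1 - circleMap 0 r θ • T) = Complex.I • ((circleMap 0 r θ)⁻¹) ^ n •
      Ring.inverse (1 - circleMap 0 r θ • T) := by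
    intro θ
    have : circleMap 0 r θ ≠ 0 := circleMap_ne_center (by exact_mod_cast hr0.ne')
    rw [smul_smul, deriv_circleMap, mul_right_comm, mul_inv_cancel₀ this, one_mul]
  simp only [e]
  rw [intervalIntegral.integral_smul, smul_smul, mul_inv, mul_assoc,
    inv_mul_cancel₀ Complex.I_ne_zero, mul_one]

theorem IsKreissBounded.norm_powerConvolution_le_integral (h : IsKreissBounded T) {r : NNReal}
    (hr0 : 0 < r) (hr : r < 1) (c : ℕ → ℝ) (n : ℕ) :
    ‖powerConvolution c T n‖ ≤ ∫ θ in (0 : ℝ)..2 * Real.pi,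
      ‖powerConvolution c (circleMap 0 r θ)⁻¹ n‖ * ‖Ring.inverse (1 - circleMap 0 r θ • T)‖ := by
  have hne : ∀ θ, circleMap 0 r θ ≠ 0 := fun θ => circleMap_ne_center (by exact_mod_cast hr0.ne')
  have hcont := h.continuous_inverse_circleMap hr
  have hinv : Continuous fun θ => (circleMap 0 r θ)⁻¹ := (continuous_circleMap 0 r).inv₀ hne
  have e : powerConvolution c T n = (2 * Real.pi : ℂ)⁻¹ • ∫ θ in (0 : ℝ)..2 * Real.pi,
      powerConvolution c (circleMap 0 r θ)⁻¹ n • Ring.inverse (1 - circleMap 0 r θ • T) := by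
    simp only [powerConvolution, Finset.sum_smul]
    rw [intervalIntegral.integral_finsetSum, Finset.smul_sum]
    · refine Finset.sum_congr rfl fun j _ => ?_
      rw [h.pow_eq_integral hr0 hr j, smul_comm, ← intervalIntegral.integral_smul]
      simp only [smul_assoc]
    · intro j _
      refine Continuous.intervalIntegrable ?_ _ _
      fun_prop
  have hpi := Real.pi_gt_three
  have hn : ‖(2 * Real.pi : ℂ)⁻¹‖ ≤ 1 := by
    rw [norm_inv, norm_mul, Complex.norm_real, Real.norm_of_nonneg Real.pi_pos.le]
    refine inv_le_one_of_one_le₀ ?_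
    norm_num
    linarith
  rw [e, norm_smul]
  refine (mul_le_of_le_one_left (norm_nonneg _) hn).trans
    ((intervalIntegral.norm_integral_le_integral_norm (by positivity)).trans (le_of_eq ?_))
  simp only [norm_smul]

/-- The radii `(n+1)/(n+2)`. -/
noncomputable def contourRadius (n : ℕ) : NNReal := (n + 1) / (n + 2)

theorem contourRadius_pos (n : ℕ) : 0 < contourRadius n := by
  unfold contourRadius; positivity

theorem coe_contourRadius (n : ℕ) : (contourRadius n : ℝ) = (n + 1) / (n + 2) := by
  simp [contourRadius]

theorem contourRadius_lt_one (n : ℕ) : contourRadius n < 1 := by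
  rw [← NNReal.coe_lt_coe, coe_contourRadius, NNReal.coe_one, div_lt_one (by positivity)]
  linarith

theorem one_sub_contourRadius (n : ℕ) : 1 - (contourRadius n : ℝ) = 1 / (n + 2) := by
  rw [coe_contourRadius]
  field_simp
  ring

theorem tendsto_contourRadius : Tendsto (fun n => (contourRadius n : ℝ)) atTop (𝓝 1) := by
  have h : Tendsto (fun n : ℕ => 1 - 1 / (((n + 1 : ℕ) : ℝ) + 1)) atTop (𝓝 (1 - 0)) :=
    tendsto_const_nhds.sub (tendsto_one_div_add_atTop_nhds_zero_nat.comp (tendsto_add_atTop_nat 1))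
  rw [sub_zero] at h
  refine h.congr fun n => ?_
  have := one_sub_contourRadius n
  push_cast
  rw [add_assoc]
  norm_num
  norm_num at this
  linarith

theorem tendsto_circleMap_contourRadius (θ : ℝ) :
    Tendsto (fun n => circleMap 0 (contourRadius n) θ) atTop (𝓝 (circleMap 0 1 θ)) := by
  simp only [circleMap, zero_add]
  refine Tendsto.mul_const _ ?_
  have := (Complex.continuous_ofReal.tendsto 1).comp tendsto_contourRadius
  simpa [Function.comp_def] using this

/-- The radius is chosen so that `|z⁻¹| = 1 + 1/(n+1)`, whose powers up to `n+1` stay below `e`. -/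
theorem norm_inv_circleMap_contourRadius_pow_le {n j : ℕ} (hj : j ≤ n + 1) (θ : ℝ) :
    ‖(circleMap 0 (contourRadius n) θ)⁻¹ ^ j‖ ≤ Real.exp 1 := by
  have h1 : (0 : ℝ) < n + 1 := by positivity
  have e : ‖(circleMap 0 (contourRadius n) θ)⁻¹‖ = 1 / ((n : ℝ) + 1) + 1 := by
    rw [norm_inv, norm_circleMap_zero, NNReal.abs_eq, coe_contourRadius]
    field_simp
    ring
  rw [norm_pow, e]
  calc (1 / ((n : ℝ) + 1) + 1) ^ j ≤ (1 / ((n : ℝ) + 1) + 1) ^ (n + 1) := by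
        refine pow_le_pow_right₀ ?_ hj
        have : 0 ≤ 1 / ((n : ℝ) + 1) := by positivity
        linarith
    _ ≤ (Real.exp (1 / ((n : ℝ) + 1))) ^ (n + 1) := by
        gcongr
        exact Real.add_one_le_exp _
    _ = Real.exp 1 := by
        rw [← Real.exp_nat_mul]
        congr 1
        push_cast
        field_simp

theorem ae_inv_circleMap_notMem_spectrum
    (hT : unitCircleMeasure (spectrum ℂ T ∩ Metric.sphere (0 : ℂ) 1) = 0) :
    ∀ᵐ θ : ℝ, θ ∈ Set.uIoc 0 (2 * Real.pi) → (circleMap 0 1 θ)⁻¹ ∉ spectrum ℂ T := by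
  have hpi := Real.pi_pos
  have hmeas : Measurable fun θ : ℝ => Complex.exp (θ * Complex.I) := by fun_prop
  have hS : MeasurableSet (spectrum ℂ T ∩ Metric.sphere (0 : ℂ) 1) :=
    ((spectrum.isClosed T).inter Metric.isClosed_sphere).measurableSet
  set N : Set ℝ := (fun θ : ℝ => Complex.exp (θ * Complex.I)) ⁻¹'
    (spectrum ℂ T ∩ Metric.sphere (0 : ℂ) 1) ∩ Set.Ioc (-Real.pi) Real.pi with hN
  have hN0 : volume N = 0 := by
    rwa [unitCircleMeasure, Measure.map_apply hmeas hS,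
      Measure.restrict_apply (hmeas hS)] at hT
  have h1 : volume ((fun θ => -θ) ⁻¹' N) = 0 :=
    (Measure.measurePreserving_neg (volume : Measure ℝ)).quasiMeasurePreserving.preimage_null hN0
  have h2 : volume ((fun θ => 2 * Real.pi - θ) ⁻¹' N) = 0 :=
    (Measure.measurePreserving_sub_left (volume : Measure ℝ)
      (2 * Real.pi)).quasiMeasurePreserving.preimage_null hN0
  have e : ∀ θ : ℝ, (circleMap 0 1 θ)⁻¹ = Complex.exp ((-θ : ℝ) * Complex.I) := by
    intro θ
    simp [circleMap, ← Complex.exp_neg]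
  have e' : ∀ θ : ℝ, (circleMap 0 1 θ)⁻¹ = Complex.exp ((2 * Real.pi - θ : ℝ) * Complex.I) := by
    intro θ
    rw [e]
    push_cast
    rw [sub_mul, sub_eq_neg_add, Complex.exp_add, Complex.exp_two_pi_mul_I, mul_one, neg_mul]
  filter_upwards [measure_eq_zero_iff_ae_notMem.1 h1, measure_eq_zero_iff_ae_notMem.1 h2]
    with θ hθ1 hθ2 hθ hmem
  rw [Set.uIoc_of_le (by positivity)] at hθ
  have hs : (circleMap 0 1 θ)⁻¹ ∈ spectrum ℂ T ∩ Metric.sphere (0 : ℂ) 1 := ⟨hmem, by simp⟩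
  -- Inversion sends the angle `θ` to `-θ`, or to `2π - θ` when `θ ≥ π`, so as to land in `(-π, π]`.
  rcases lt_or_ge θ Real.pi with hlt | hge
  · exact hθ1 ⟨by rw [Set.mem_preimage, ← e]; exact hs, by constructor <;> linarith [hθ.1]⟩
  · exact hθ2 ⟨by rw [Set.mem_preimage, ← e']; exact hs,
      by constructor <;> linarith [hθ.1, hθ.2]⟩

theorem tendsto_inverse_of_inv_notMem_spectrum {z : ℂ} (hz : z ≠ 0)
    (h : z⁻¹ ∉ spectrum ℂ T) {w : ℕ → ℂ} (hw : Tendsto w atTop (𝓝 z)) :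
    Tendsto (fun n => Ring.inverse (1 - w n • T)) atTop (𝓝 (Ring.inverse (1 - z • T))) := by
  have hu : IsUnit (1 - z • T) := by
    have h1 : IsUnit (algebraMap ℂ (X →L[ℂ] X) z⁻¹ - T) := spectrum.notMem_iff.1 h
    have h2 : 1 - z • T = z • (algebraMap ℂ (X →L[ℂ] X) z⁻¹ - T) := by
      rw [smul_sub, Algebra.algebraMap_eq_smul_one, smul_smul, mul_inv_cancel₀ hz, one_smul]
    rw [h2]
    exact h1.smul (Units.mk0 z hz)
  obtain ⟨u, hu⟩ := hu
  have hc := NormedRing.inverse_continuousAt u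
  rw [hu] at hc
  exact hc.tendsto.comp (tendsto_const_nhds.sub (hw.smul_const T))

/-- Away from `z = 1`, Abel summation bounds the sum by a multiple of `k^b(n+1) + 1`; this is
`o(k^{b+1}(n))` because `k^b(n+1) = b k^{b+1}(n) / (n+1)`. -/
theorem tendsto_norm_powerConvolution_div_of_ne_one {b : ℝ} (hb : 0 < b) {θ : ℝ}
    (hθ : circleMap 0 1 θ ≠ 1) :
    Tendsto (fun n => ‖powerConvolution (cesaroKernel b) (circleMap 0 (contourRadius n) θ)⁻¹ n‖ /
      cesaroKernel (b + 1) n) atTop (𝓝 0) := by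
  have hk : ∀ n, 0 < cesaroKernel (b + 1) n := cesaroKernel_pos (by linarith)
  set q : ℕ → ℂ := fun n => (circleMap 0 (contourRadius n) θ)⁻¹ with hq
  have hne : circleMap 0 1 θ ≠ 0 := circleMap_ne_center one_ne_zero
  have hlim : Tendsto (fun n => ‖q n - 1‖) atTop (𝓝 ‖(circleMap 0 1 θ)⁻¹ - 1‖) :=
    (((tendsto_circleMap_contourRadius θ).inv₀ hne).sub_const 1).norm
  have hpos : ‖(circleMap 0 1 θ)⁻¹ - 1‖ ≠ 0 := by
    rw [norm_ne_zero_iff, sub_ne_zero]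
    exact fun h => hθ (inv_eq_one.1 h)
  have hmon : Monotone (cesaroKernel b) ∨ Antitone (cesaroKernel b) := by
    rcases le_total 1 b with h | h
    · exact Or.inl (monotone_cesaroKernel h)
    · exact Or.inr (antitone_cesaroKernel hb.le h)
  have hbound : ∀ n, ‖q n - 1‖ * (‖powerConvolution (cesaroKernel b) (q n) n‖ /
      cesaroKernel (b + 1) n) ≤
      2 * Real.exp 1 * (b * (1 / ((n : ℝ) + 1)) + 1 / cesaroKernel (b + 1) n) := by
    intro n
    have h1 := norm_sub_one_mul_powerConvolution_le hmon (cesaroKernel_nonneg hb.le) (n := n)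
      (z := q n) (D := Real.exp 1) fun j hj => norm_inv_circleMap_contourRadius_pow_le hj θ
    have h2 : cesaroKernel b (n + 1) ≤
        b * (1 / ((n : ℝ) + 1)) * cesaroKernel (b + 1) n := by
      have h3 := mul_cesaroKernel_add_one hb.le n
      have h4 : (0 : ℝ) < n + 1 := by positivity
      rw [cesaroKernel_succ hb.le, mul_div_assoc', mul_comm _ (b + (n : ℝ)), ← h3, mul_one_div,
        div_mul_eq_mul_div]
    have h0 := cesaroKernel_apply_zero hb.le
    have hkn := hk n
    rw [mul_div_assoc', div_le_iff₀ hkn]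
    refine h1.trans ?_
    rw [h0]
    have h5 : 2 * Real.exp 1 * (b * (1 / ((n : ℝ) + 1)) + 1 / cesaroKernel (b + 1) n) *
        cesaroKernel (b + 1) n =
        2 * Real.exp 1 * (b * (1 / ((n : ℝ) + 1)) * cesaroKernel (b + 1) n + 1) := by
      field_simp
    rw [h5, mul_right_comm]
    gcongr
  have hz : Tendsto (fun n => ‖q n - 1‖ * (‖powerConvolution (cesaroKernel b) (q n) n‖ /
      cesaroKernel (b + 1) n)) atTop (𝓝 0) := by
    refine squeeze_zero (fun n => mul_nonneg (norm_nonneg _)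
      (div_nonneg (norm_nonneg _) (hk n).le)) hbound ?_
    have h1 : Tendsto (fun n : ℕ => 1 / cesaroKernel (b + 1) n) atTop (𝓝 0) := by
      simpa [Pi.inv_def] using
        (tendsto_cesaroKernel_atTop (lt_add_of_pos_left 1 hb)).inv_tendsto_atTop
    simpa using ((tendsto_one_div_add_atTop_nhds_zero_nat.const_mul b).add h1).const_mul
      (2 * Real.exp 1)
  have hdiv := hz.div hlim hpos
  rw [zero_div] at hdiv
  refine hdiv.congr' ?_
  filter_upwards [hlim.eventually_ne hpos] with n hn
  simp only [Pi.div_apply]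
  rw [mul_div_cancel_left₀ _ hn]

theorem IsKreissBounded.tendsto_norm_cesaroSum_div (h : IsKreissBounded T) {b : ℝ} (hb : 0 ≤ b)
    (hb' : 0 < b ∨ unitCircleMeasure (spectrum ℂ T ∩ Metric.sphere (0 : ℂ) 1) = 0) :
    Tendsto (fun n : ℕ => ‖cesaroSum T b n‖ / ((n + 1) * cesaroKernel (b + 1) n))
      atTop (𝓝 0) := by
  obtain ⟨C, hC0, hC⟩ := h.exists_norm_inverse_le
  have hk : ∀ n, 0 < cesaroKernel (b + 1) n := cesaroKernel_pos (by linarith)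
  have hk1 : ∀ n : ℕ, 0 < ((n : ℝ) + 1) * cesaroKernel (b + 1) n := fun n =>
    mul_pos (by positivity) (hk n)
  set P : ℕ → ℝ → ℝ := fun n θ =>
    ‖powerConvolution (cesaroKernel b) (circleMap 0 (contourRadius n) θ)⁻¹ n‖ with hP
  set R : ℕ → ℝ → ℝ := fun n θ => ‖Ring.inverse (1 - circleMap 0 (contourRadius n) θ • T)‖ with hR
  have hne : ∀ n θ, circleMap 0 (contourRadius n) θ ≠ 0 := fun n θ =>
    circleMap_ne_center (by exact_mod_cast (contourRadius_pos n).ne')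
  have hPle : ∀ n θ, P n θ / cesaroKernel (b + 1) n ≤ Real.exp 1 := by
    intro n θ
    have h1 := norm_powerConvolution_le (cesaroKernel_nonneg hb) (n := n)
      (x := (circleMap 0 (contourRadius n) θ)⁻¹) (D := Real.exp 1) fun j hj =>
        norm_inv_circleMap_contourRadius_pow_le (hj.trans (Nat.le_succ n)) θ
    rw [sum_cesaroKernel hb] at h1
    rw [div_le_iff₀ (hk n), mul_comm]
    exact h1
  have hRle : ∀ n θ, R n θ / (n + 1) ≤ 2 * C := by
    intro n θ
    have hnorm : ‖circleMap 0 (contourRadius n) θ‖ = contourRadius n := by simp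
    have h1 := hC (circleMap 0 (contourRadius n) θ) (hne n θ)
      (by rw [hnorm]; exact_mod_cast contourRadius_lt_one n)
    rw [hnorm, one_sub_contourRadius, div_div_eq_mul_div, div_one] at h1
    rw [div_le_iff₀ (by positivity)]
    refine h1.trans ?_
    -- The Kreiss bound at this radius is `C (n+2)`, at most `2C (n+1)`.
    nlinarith [mul_nonneg hC0.le (Nat.cast_nonneg (α := ℝ) n)]
  have hP0 : ∀ n θ, 0 ≤ P n θ / cesaroKernel (b + 1) n := fun n θ =>
    div_nonneg (norm_nonneg _) (hk n).le
  have hR0 : ∀ n θ, 0 ≤ R n θ / (n + 1) := fun n θ => div_nonneg (norm_nonneg _) (by positivity)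
  have hcont : ∀ n, Continuous fun θ => P n θ / cesaroKernel (b + 1) n * (R n θ / (n + 1)) := by
    intro n
    have hinv : Continuous fun θ => (circleMap 0 (contourRadius n) θ)⁻¹ :=
      (continuous_circleMap 0 _).inv₀ (hne n)
    have hc := h.continuous_inverse_circleMap (contourRadius_lt_one n)
    refine (Continuous.div_const ?_ _).mul (hc.norm.div_const _)
    refine Continuous.norm ?_
    simp only [powerConvolution]
    exact continuous_finsetSum _ fun j _ => by fun_prop
  have hlim : ∀ᵐ θ : ℝ, θ ∈ Set.uIoc 0 (2 * Real.pi) →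
      Tendsto (fun n => P n θ / cesaroKernel (b + 1) n * (R n θ / (n + 1))) atTop (𝓝 0) := by
    rcases hb' with hb' | hT
    -- On `(0, 2π]` only `θ = 2π` gives `z = 1`.
    · have hae : ∀ᵐ θ : ℝ, θ ≠ 2 * Real.pi := by simp [ae_iff]
      filter_upwards [hae] with θ hθ hmem
      rw [Set.uIoc_of_le (by positivity)] at hmem
      have h1 : circleMap 0 1 θ ≠ 1 := by
        intro heq
        simp only [circleMap, zero_add, Complex.ofReal_one, one_mul] at heq
        obtain ⟨m, hm⟩ := Complex.exp_eq_one_iff.1 heq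
        have hm' : (θ : ℂ) = ((m * (2 * Real.pi) : ℝ) : ℂ) := by
          have := mul_right_cancel₀ Complex.I_ne_zero (hm.trans (mul_assoc _ _ _).symm)
          rw [this]; push_cast; ring
        have hm2 : θ = m * (2 * Real.pi) := by exact_mod_cast hm'
        have hpi := Real.pi_pos
        have hlt := lt_of_le_of_ne hmem.2 hθ
        have m1 : (m : ℝ) < 1 := by nlinarith
        have m0 : (0 : ℝ) < m := by
          by_contra! hle
          nlinarith [hmem.1]
        have m1' : m < 1 := by exact_mod_cast m1
        have m0' : 0 < m := by exact_mod_cast m0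
        omega
      refine squeeze_zero (fun n => mul_nonneg (hP0 n θ) (hR0 n θ))
        (fun n => mul_le_mul_of_nonneg_left (hRle n θ) (hP0 n θ)) ?_
      simpa using (tendsto_norm_powerConvolution_div_of_ne_one hb' h1).mul_const (2 * C)
    · filter_upwards [ae_inv_circleMap_notMem_spectrum hT] with θ hθ hmem
      have h1 := (tendsto_inverse_of_inv_notMem_spectrum (circleMap_ne_center one_ne_zero)
        (hθ hmem) (tendsto_circleMap_contourRadius θ)).norm
      have h2 := h1.mul tendsto_one_div_add_atTop_nhds_zero_nat
      rw [mul_zero] at h2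
      refine squeeze_zero (fun n => mul_nonneg (hP0 n θ) (hR0 n θ))
        (fun n => mul_le_mul_of_nonneg_right (hPle n θ) (hR0 n θ)) ?_
      have h3 := h2.const_mul (Real.exp 1)
      rw [mul_zero] at h3
      simpa only [mul_one_div] using h3
  have hint := intervalIntegral.tendsto_integral_filter_of_dominated_convergence
    (μ := volume) (a := 0) (b := 2 * Real.pi) (l := atTop)
    (F := fun n θ => P n θ / cesaroKernel (b + 1) n * (R n θ / (n + 1))) (f := fun _ => 0)
    (fun _ => Real.exp 1 * (2 * C))
    (Eventually.of_forall fun n => (hcont n).aestronglyMeasurable)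
    (Eventually.of_forall fun n => Eventually.of_forall fun θ _ => by
      rw [Real.norm_of_nonneg (mul_nonneg (hP0 n θ) (hR0 n θ))]
      exact mul_le_mul (hPle n θ) (hRle n θ) (hR0 n θ) (Real.exp_pos 1).le)
    intervalIntegrable_const hlim
  rw [intervalIntegral.integral_zero] at hint
  refine squeeze_zero (fun n => div_nonneg (norm_nonneg _) (hk1 n).le) (fun n => ?_) hint
  have h1 := h.norm_powerConvolution_le_integral (contourRadius_pos n) (contourRadius_lt_one n)
    (cesaroKernel b) n
  rw [cesaroSum_eq_powerConvolution]
  refine (div_le_div_of_nonneg_right h1 (hk1 n).le).trans (le_of_eq ?_)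
  rw [← intervalIntegral.integral_div]
  congr 1
  ext θ
  rw [div_mul_div_comm, mul_comm (cesaroKernel (b + 1) n)]

theorem IsKreissBounded.tendsto_norm_cesaroMean_succ_sub (h : IsKreissBounded T) {a : ℝ}
    (ha : 1 ≤ a)
    (ha' : 1 < a ∨ unitCircleMeasure (spectrum ℂ T ∩ Metric.sphere (0 : ℂ) 1) = 0) :
    Tendsto (fun n : ℕ => ‖cesaroMean T a (n + 1) - cesaroMean T a n‖) atTop (𝓝 0) := by
  have hb : 0 ≤ a - 1 := sub_nonneg.2 ha
  have ha0 : 0 < a := by linarith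
  refine _root_.tendsto_norm_cesaroMean_succ_sub ha0.le ?_
    (h.tendsto_norm_cesaroSum_div ha0.le (Or.inl ha0))
  have h1 := ((h.tendsto_norm_cesaroSum_div hb (ha'.imp_left sub_pos.2)).comp
    (tendsto_add_atTop_nat 1)).const_mul a
  rw [mul_zero] at h1
  refine squeeze_zero (fun n => div_nonneg (norm_nonneg _)
    (cesaroKernel_nonneg (by linarith) _)) (fun n => ?_) h1
  have h2 := cesaroSum_add_one_succ_sub T hb n
  have h3 := mul_cesaroKernel_add_one ha0.le (n + 1)
  have hk := cesaroKernel_pos ha0 (n + 1)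
  rw [sub_add_cancel] at h2
  simp only [Function.comp_apply, sub_add_cancel]
  -- This trades `k^{a+1}` for `(n+1) k^a`, the normalization of sums of order `a - 1`.
  have h4 : cesaroKernel (a + 1) (n + 1) =
      (a + (n + 1 : ℕ)) * cesaroKernel a (n + 1) / a := by
    rw [← h3]; field_simp
  rw [h2, h4, div_div_eq_mul_div, mul_comm, mul_div_assoc]
  gcongr a * (_ / (?_ * _))
  linarith

end kreiss

theorem theorem3p3 {X : Type*} [NormedAddCommGroup X] [NormedSpace ℂ X] [CompleteSpace X]
    (T : X →L[ℂ] X) (α : ℝ)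
    (h : (IsAbsolutelyCesaroBounded T α ∧ 0 < α ∧ α ≤ 1) ∨
      (IsKreissBounded T ∧ 1 ≤ α ∧ α < 2 ∧
        unitCircleMeasure (spectrum ℂ T ∩ Metric.sphere (0 : ℂ) 1) = 0) ∨
      (IsKreissBounded T ∧ 2 ≤ α)) :
    Tendsto (fun n : ℕ => ‖cesaroMean T α (n + 1) - cesaroMean T α n‖) atTop (𝓝 0) := by
  rcases h with ⟨hT, h0, h1⟩ | ⟨hT, h1, -, hm⟩ | ⟨hT, h2⟩
  · exact hT.tendsto_norm_cesaroMean_succ_sub h0 h1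
  · exact hT.tendsto_norm_cesaroMean_succ_sub h1 (Or.inr hm)
  · exact hT.tendsto_norm_cesaroMean_succ_sub (by linarith) (Or.inl (by linarith))
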